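/- Let $m,N,k\ge 0$ be integers, $\lambda\in\mathbb R$, $\alpha,\beta>-1$, $I=(0,1)$ and $\gamma=\frac{\beta-\lambda}{2}$. For $a,b\in\mathbb R$ put $\chi^{a,b}(t)=(-\log t)^a t^b$, and let $L^2_{\chi^{a,b}}(I)$ be the space of real functions on $I$ with norm $\|v\|_{\chi^{a,b}}=\big(\int_0^1 v(t)^2\chi^{a,b}(t)\,dt\big)^{1/2}<\infty$. Let $\widehat\partial_{\gamma,t}u=t^{1+\gamma}\,\partial_t\{t^{-\gamma}u\}$, with $\partial_t$ the weak derivative on $I$, and let $A^m_{\alpha,\beta,\lambda}(I)$ be the space of those $v$ for which $\widehat\partial_{\gamma,t}^{\,j}v$ exists and lies in $L^2_{\chi^{\alpha+j,\lambda}}(I)$ for $j=0,1,\dots,m$. Let $\mathcal P_N=\mathrm{span}\{t^{\gamma}(\log t)^j: 0\le j\le N\}$; this is the span of the first $N+1$ generalized log orthogonal functions $t^{\gamma}\mathscr L^{(\alpha)}_n(-(\beta+1)\log t)$, $0\le n\le N$, where $\mathscr L^{(\alpha)}_n$ are the Laguerre polynomials. For $u\in L^2_{\chi^{\alpha,\lambda}}(I)$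 let $\pi_N^{\alpha,\beta,\lambda}u$ be the element of $\mathcal P_N$ with $$\int_0^1\big(u-\pi_N^{\alpha,\beta,\lambda}u\big)(t)\,v(t)\,\chi^{\alpha,\lambda}(t)\,dt=0\qquad\text{for all } v\in\mathcal P_N .$$ Then for every $u\in A^m_{\alpha,\beta,\lambda}(I)$ and $0\le k\le\widetilde m:=\min\{m,N+1\}$, the projection $\pi_N^{\alpha,\beta,\lambda}u$ exists and is unique, $u-\pi_N^{\alpha,\beta,\lambda}u\in A^m_{\alpha,\beta,\lambda}(I)$, and $$\big\|\widehat\partial_{\gamma,t}^{\,k}\big(u-\pi_N^{\alpha,\beta,\lambda}u\big)\big\|_{\chi^{\alpha+k,\lambda}}\le\sqrt{(\beta+1)^{k-\widetilde m}\,\frac{(N-\widetilde m+1)!}{(N-k+1)!}}\;\big\|\widehat\partial_{\gamma,t}^{\,\widetilde m}u\big\|_{\chi^{\alpha+\widetilde m,\lambda}} .$$ -/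

import Mathlib

open MeasureTheory Set
open scoped ContDiff ENNReal

noncomputable section

namespace GLOF

/-- The measure `(-log t)^a * t^b dt` on the interval `(0,1)`. -/
def logMeasure (a b : ℝ) : Measure ℝ :=
  (volume.restrict (Ioo (0 : ℝ) 1)).withDensity
    (fun t => ENNReal.ofReal ((-Real.log t) ^ a * t ^ b))

/-- `w` is a weak derivative of `v` on `(0,1)`: both are locally integrable there and
`∫ v φ' = - ∫ w φ` for all smooth `φ` with compact support in `(0,1)`. -/
def HasWeakDeriv (v w : ℝ → ℝ) : Prop :=
  LocallyIntegrableOn v (Ioo (0 : ℝ) 1) ∧ LocallyIntegrableOn w (Ioo (0 : ℝ) 1) ∧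
    ∀ φ : ℝ → ℝ, ContDiff ℝ ∞ φ → HasCompactSupport φ → tsupport φ ⊆ Ioo (0 : ℝ) 1 →
      ∫ t in Ioo (0 : ℝ) 1, v t * deriv φ t = -∫ t in Ioo (0 : ℝ) 1, w t * φ t

/-- `v` has a weak derivative on `(0,1)` that is a locally integrable function. -/
def WeaklyDifferentiable (v : ℝ → ℝ) : Prop := ∃ w, HasWeakDeriv v w

open Classical in
/-- The weak derivative of `v` on `(0,1)` (unique up to a null set), and `0` if there is none. -/
def weakDeriv (v : ℝ → ℝ) : ℝ → ℝ :=
  if h : WeaklyDifferentiable v then h.choose else 0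

/-- The pseudo-derivative `t^(1+γ) ∂_t (t^(-γ) u)`. -/
def pseudoDeriv (γ : ℝ) (u : ℝ → ℝ) : ℝ → ℝ :=
  fun t => t ^ (1 + γ) * weakDeriv (fun s => s ^ (-γ) * u s) t

/-- The space `A^m_{α,β,λ}`: the functions whose iterated pseudo-derivatives (with parameter
`γ = (β-λ)/2`) of order `j = 0, …, m` exist and lie in `L²` with weight
`(-log t)^(α+j) t^λ`. -/
def MemA (m : ℕ) (α β lam : ℝ) (u : ℝ → ℝ) : Prop :=
  (∀ j : ℕ, j < m →
    WeaklyDifferentiable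
      (fun s => s ^ (-((β - lam) / 2)) * (pseudoDeriv ((β - lam) / 2))^[j] u s)) ∧
  ∀ j : ℕ, j ≤ m →
    MemLp ((pseudoDeriv ((β - lam) / 2))^[j] u) 2 (logMeasure (α + j) lam)

/-- `P_N^{log t}`, the span of `1, log t, …, (log t)^N`. -/
def logPoly (N : ℕ) : Submodule ℝ (ℝ → ℝ) :=
  Submodule.span ℝ {f | ∃ j : ℕ, j ≤ N ∧ f = fun t => Real.log t ^ j}

/-- `p` is the `L²` projection, with weight `(-log t)^α t^λ`, of `u` onto
`{t^((β-λ)/2) q : q ∈ P_N^{log t}}`. -/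
def IsProjection (N : ℕ) (α β lam : ℝ) (u p : ℝ → ℝ) : Prop :=
  (∃ q ∈ logPoly N, p = fun t => t ^ ((β - lam) / 2) * q t) ∧
    ∀ q ∈ logPoly N,
      ∫ t, (u t - p t) * (t ^ ((β - lam) / 2) * q t) ∂(logMeasure α lam) = 0

end GLOF

end

namespace GLOF

/-! Removing the factor `t^γ` turns the weight exponent `lam` into `β`, the pseudo-derivative into
`t ∂_t`, and the trial space into polynomials in `log t` of degree less than `n = N + 1`. On `P(log
t)`, `t ∂_t` acts as `P ↦ P'`. Integration by parts moves it to an operator `logAdjoint`, which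
raises the degree by at most one, while the power of `-log t` in the weight drops by one.

The composite `T = logAdjoint ∘ derivative` is a Laguerre operator, triangular on degrees with
diagonal entries `(b + 1) n`. Since log-polynomials are total in the weighted space, this yields a
sharp Poincaré inequality (`HasLogDeriv.mul_eLpNorm_sq_le`): if `e` is orthogonal to degrees below
`n`, then `(b + 1) n ‖e‖² ≤ ‖t ∂_t e‖²`.

The `j`-th derivative of the error stays orthogonal to degrees below `n - j`, again by the adjoint.
Iterating from order `k` to `M = min m n` multiplies the constants `(β + 1)(n - j)` into `(β + 1)^(M
- k) (n - k)! / (n - M)!`. At order `M` the projection part is orthogonal to the error, so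
Pythagoras bounds the error by the derivative of `u`. -/

/-! ### The weighted measures and integrability of log-polynomials. -/

lemma measurable_logWeight (a b : ℝ) : Measurable fun t : ℝ => (-Real.log t) ^ a * t ^ b := by
  fun_prop

lemma logWeight_pos (a b : ℝ) {t : ℝ} (ht : t ∈ Ioo (0 : ℝ) 1) : 0 < (-Real.log t) ^ a * t ^ b :=
  mul_pos (Real.rpow_pos_of_pos (neg_pos.2 (Real.log_neg ht.1 ht.2)) _)
    (Real.rpow_pos_of_pos ht.1 _)

lemma logMeasure_absolutelyContinuous (a b : ℝ) :
    logMeasure a b ≪ volume.restrict (Ioo (0 : ℝ) 1) :=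
  withDensity_absolutelyContinuous _ _

lemma absolutelyContinuous_logMeasure (a b : ℝ) :
    volume.restrict (Ioo (0 : ℝ) 1) ≪ logMeasure a b := by
  refine withDensity_absolutelyContinuous' (measurable_logWeight a b).ennreal_ofReal.aemeasurable ?_
  filter_upwards [ae_restrict_mem measurableSet_Ioo] with t ht
  simpa using logWeight_pos a b ht

lemma ae_logMeasure (a b : ℝ) : ae (logMeasure a b) = ae (volume.restrict (Ioo (0 : ℝ) 1)) :=
  le_antisymm (logMeasure_absolutelyContinuous a b).ae_le
    (absolutelyContinuous_logMeasure a b).ae_le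

lemma ae_mem_Ioo_logMeasure (a b : ℝ) : ∀ᵐ t ∂logMeasure a b, t ∈ Ioo (0 : ℝ) 1 := by
  rw [ae_logMeasure]
  exact ae_restrict_mem measurableSet_Ioo

lemma aestronglyMeasurable_logMeasure_iff {a b : ℝ} {f : ℝ → ℝ} :
    AEStronglyMeasurable f (logMeasure a b) ↔
      AEStronglyMeasurable f (volume.restrict (Ioo (0 : ℝ) 1)) :=
  ⟨fun h => h.mono_ac (absolutelyContinuous_logMeasure a b),
    fun h => h.mono_ac (logMeasure_absolutelyContinuous a b)⟩

lemma integral_logMeasure (a b : ℝ) (f : ℝ → ℝ) :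
    ∫ t, f t ∂logMeasure a b = ∫ t in Ioo (0 : ℝ) 1, (-Real.log t) ^ a * t ^ b * f t := by
  rw [logMeasure, integral_withDensity_eq_integral_toReal_smul
    (measurable_logWeight a b).ennreal_ofReal (by simp)]
  refine setIntegral_congr_fun measurableSet_Ioo fun t ht => ?_
  simp [ENNReal.toReal_ofReal (logWeight_pos a b ht).le]

lemma integrable_logMeasure_iff {a b : ℝ} {f : ℝ → ℝ} :
    Integrable f (logMeasure a b) ↔
      IntegrableOn (fun t => (-Real.log t) ^ a * t ^ b * f t) (Ioo (0 : ℝ) 1) := by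
  rw [logMeasure, integrable_withDensity_iff_integrable_smul'
    (measurable_logWeight a b).ennreal_ofReal (by simp)]
  refine integrableOn_congr_fun (fun t ht => ?_) measurableSet_Ioo
  simp [ENNReal.toReal_ofReal (logWeight_pos a b ht).le]

lemma image_exp_neg_Ioi : (fun x : ℝ => Real.exp (-x)) '' Ioi 0 = Ioo 0 1 := by
  ext t
  constructor
  · rintro ⟨x, hx, rfl⟩
    exact ⟨Real.exp_pos _, by simpa using hx⟩
  · intro ht
    exact ⟨-Real.log t, neg_pos.2 (Real.log_neg ht.1 ht.2), by simp [Real.exp_log ht.1]⟩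

/-- The substitution `t = exp (-x)` turns this into a Gamma integral. -/
lemma integrableOn_logWeight {a b : ℝ} (ha : -1 < a) (hb : -1 < b) :
    IntegrableOn (fun t : ℝ => (-Real.log t) ^ a * t ^ b) (Ioo 0 1) := by
  rw [← image_exp_neg_Ioi, integrableOn_image_iff_integrableOn_abs_deriv_smul measurableSet_Ioi
    (f' := fun x => -Real.exp (-x))]
  · refine (integrableOn_rpow_mul_exp_neg_mul_rpow ha one_pos
      (show 0 < b + 1 by linarith)).congr_fun (fun x hx => ?_) measurableSet_Ioi
    simp only [Real.rpow_one, abs_neg, abs_of_pos (Real.exp_pos _), Real.log_exp, neg_neg,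
      smul_eq_mul, ← Real.exp_mul]
    rw [mul_left_comm, ← Real.exp_add]
    ring_nf
  · intro x _
    simpa using ((hasDerivAt_neg x).exp).hasDerivWithinAt
  · intro x _ y _ h
    simpa using h

lemma isFiniteMeasure_logMeasure {a b : ℝ} (ha : -1 < a) (hb : -1 < b) :
    IsFiniteMeasure (logMeasure a b) := by
  rw [← integrable_const_iff_isFiniteMeasure (one_ne_zero (α := ℝ)), integrable_logMeasure_iff]
  simpa using integrableOn_logWeight ha hb

lemma integrable_rpow_logMeasure {a b s : ℝ} (ha : -1 < a) (hs : -1 < b + s) :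
    Integrable (fun t => t ^ s) (logMeasure a b) := by
  rw [integrable_logMeasure_iff]
  refine (integrableOn_logWeight ha hs).congr_fun (fun t ht => ?_) measurableSet_Ioo
  rw [mul_assoc, ← Real.rpow_add ht.1]

lemma integrable_exp_mul_log_logMeasure {a b s : ℝ} (ha : -1 < a) (hs : -1 < b + s) :
    Integrable (fun t => Real.exp (s * Real.log t)) (logMeasure a b) := by
  refine (integrable_rpow_logMeasure ha hs).congr ?_
  filter_upwards [ae_mem_Ioo_logMeasure a b] with t ht
  rw [Real.rpow_def_of_pos ht.1, mul_comm]

lemma memLp_exp_mul_log {a b s : ℝ} (ha : -1 < a) (hs : -1 < b + 2 * s) :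
    MemLp (fun t => Real.exp (s * Real.log t)) 2 (logMeasure a b) := by
  rw [memLp_two_iff_integrable_sq (by fun_prop)]
  refine (integrable_exp_mul_log_logMeasure ha hs).congr (.of_forall fun t => ?_)
  simp only [← Real.exp_nat_mul]
  ring_nf

/-- Exponential moments of `log` near `0` give all its power moments, and later the analyticity
behind totality. -/
lemma zero_mem_interior_integrableExpSet {a b : ℝ} (ha : -1 < a) (hb : -1 < b) :
    (0 : ℝ) ∈ interior (ProbabilityTheory.integrableExpSet Real.log (logMeasure a b)) := by
  rw [mem_interior]
  exact ⟨Ioi (-(b + 1)), fun s hs => integrable_exp_mul_log_logMeasure ha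
    (by rw [mem_Ioi] at hs; linarith), isOpen_Ioi, by rw [mem_Ioi]; linarith⟩

lemma memLp_log_pow {a b : ℝ} (ha : -1 < a) (hb : -1 < b) (n : ℕ) :
    MemLp (fun t => Real.log t ^ n) 2 (logMeasure a b) := by
  rw [memLp_two_iff_integrable_sq (by fun_prop)]
  simp_rw [← pow_mul]
  exact ProbabilityTheory.integrable_pow_of_mem_interior_integrableExpSet
    (zero_mem_interior_integrableExpSet ha hb) _

lemma memLp_polynomial_log {a b : ℝ} (ha : -1 < a) (hb : -1 < b) (P : Polynomial ℝ) :
    MemLp (fun t => P.eval (Real.log t)) 2 (logMeasure a b) := by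
  simp_rw [Polynomial.eval_eq_sum_range]
  exact memLp_finsetSum _ fun i _ => (memLp_log_pow ha hb i).const_mul _

/-- Used with `γ = (β - lam) / 2`, which replaces the exponent `lam` by `β`. -/
lemma eLpNorm_rpow_mul (a b γ : ℝ) (f : ℝ → ℝ) :
    eLpNorm (fun t => t ^ γ * f t) 2 (logMeasure a b) = eLpNorm f 2 (logMeasure a (b + 2 * γ)) := by
  simp only [eLpNorm_eq_lintegral_rpow_enorm_toReal two_ne_zero ENNReal.ofNat_ne_top, logMeasure]
  rw [lintegral_withDensity_eq_lintegral_mul_non_measurable _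
      (measurable_logWeight _ _).ennreal_ofReal (by simp),
    lintegral_withDensity_eq_lintegral_mul_non_measurable _
      (measurable_logWeight _ _).ennreal_ofReal (by simp)]
  congr 1
  refine setLIntegral_congr_fun measurableSet_Ioo fun t ht => ?_
  simp only [Pi.mul_apply, enorm_mul, ENNReal.toReal_ofNat]
  rw [ENNReal.mul_rpow_of_nonneg _ _ zero_le_two, ← mul_assoc]
  congr 1
  rw [Real.enorm_of_nonneg (Real.rpow_pos_of_pos ht.1 _).le,
    ENNReal.ofReal_rpow_of_nonneg (Real.rpow_pos_of_pos ht.1 _).le zero_le_two,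
    ← ENNReal.ofReal_mul (logWeight_pos a b ht).le, ← Real.rpow_mul ht.1.le, mul_assoc,
    ← Real.rpow_add ht.1, mul_comm γ]

lemma memLp_rpow_mul_iff {a b γ : ℝ} {f : ℝ → ℝ} :
    MemLp (fun t => t ^ γ * f t) 2 (logMeasure a b) ↔ MemLp f 2 (logMeasure a (b + 2 * γ)) := by
  rw [MemLp, MemLp, eLpNorm_rpow_mul, aestronglyMeasurable_logMeasure_iff,
    aestronglyMeasurable_logMeasure_iff]
  refine and_congr_left fun _ => ⟨fun h => ?_, fun h => ?_⟩
  · have h2 : AEStronglyMeasurable (fun t : ℝ => t ^ (-γ) * (t ^ γ * f t))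
        (volume.restrict (Ioo (0 : ℝ) 1)) :=
      AEStronglyMeasurable.mul (by fun_prop) h
    refine h2.congr ?_
    filter_upwards [ae_restrict_mem measurableSet_Ioo] with t ht
    rw [← mul_assoc, ← Real.rpow_add ht.1]
    simp
  · exact AEStronglyMeasurable.mul (by fun_prop) h

lemma integral_rpow_mul_mul (a b γ : ℝ) (f g : ℝ → ℝ) :
    ∫ t, (t ^ γ * f t) * (t ^ γ * g t) ∂logMeasure a b =
      ∫ t, f t * g t ∂logMeasure a (b + 2 * γ) := by
  rw [integral_logMeasure, integral_logMeasure]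
  refine setIntegral_congr_fun measurableSet_Ioo fun t ht => ?_
  simp only [two_mul]
  rw [Real.rpow_add ht.1, Real.rpow_add ht.1]
  ring

/-! ### Moment determinacy and totality of log-polynomials. -/

open ProbabilityTheory in
/-- Finite measures with the same moments, with moment generating functions finite near `0`,
give the same distribution. -/
lemma map_eq_of_integral_pow_eq {Ω : Type*} {mΩ : MeasurableSpace Ω} {μ μ' : Measure Ω}
    [IsFiniteMeasure μ] [IsFiniteMeasure μ'] {X : Ω → ℝ} (hX : Measurable X)
    (h : (0 : ℝ) ∈ interior (integrableExpSet X μ))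
    (h' : (0 : ℝ) ∈ interior (integrableExpSet X μ'))
    (hpow : ∀ n : ℕ, ∫ x, X x ^ n ∂μ = ∫ x, X x ^ n ∂μ') :
    μ.map X = μ'.map X := by
  set S : Set ℝ := interior (integrableExpSet X μ) ∩ interior (integrableExpSet X μ')
  have hS : Convex ℝ S := convex_integrableExpSet.interior.inter convex_integrableExpSet.interior
  have hA : AnalyticOnNhd ℂ (complexMGF X μ) {z | z.re ∈ S} :=
    fun z hz => analyticAt_complexMGF hz.1
  have hA' : AnalyticOnNhd ℂ (complexMGF X μ') {z | z.re ∈ S} :=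
    fun z hz => analyticAt_complexMGF hz.2
  have h0 : (0 : ℂ) ∈ {z : ℂ | z.re ∈ S} := ⟨by simpa using h, by simpa using h'⟩
  -- The derivatives of the complex moment generating function at `0` are the moments, so the
  -- difference vanishes there to infinite order.
  have hev : ∀ᶠ z in nhds (0 : ℂ), complexMGF X μ z - complexMGF X μ' z = 0 := by
    rw [← analyticOrderAt_eq_top, ENat.eq_top_iff_forall_ge]
    intro n
    have h1 := hA 0 h0
    have h2 := hA' 0 h0
    have h3 : AnalyticAt ℂ (fun z => complexMGF X μ z - complexMGF X μ' z) 0 := h1.sub h2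
    rw [natCast_le_analyticOrderAt_iff_iteratedDeriv_eq_zero h3]
    intro i _
    rw [iteratedDeriv_fun_sub h1.contDiffAt h2.contDiffAt,
      iteratedDeriv_complexMGF (by simpa using h), iteratedDeriv_complexMGF (by simpa using h')]
    have := congrArg (fun r : ℝ => (r : ℂ)) (hpow i)
    simp only [← integral_complex_ofReal] at this
    simpa [sub_eq_zero] using this
  have heq : EqOn (complexMGF X μ) (complexMGF X μ') {z | z.re ∈ S} :=
    hA.eqOn_of_preconnected_of_eventuallyEq hA'
      (hS.linear_preimage Complex.reLm).isPreconnected h0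
      (hev.mono fun z hz => sub_eq_zero.1 hz)
  -- The imaginary axis lies in the strip of analyticity, and there the function is the
  -- characteristic function.
  refine Measure.ext_of_charFun (funext fun t => ?_)
  rw [← complexMGF_mul_I hX.aemeasurable, ← complexMGF_mul_I hX.aemeasurable]
  exact heq ⟨by simpa using h, by simpa using h'⟩

lemma map_log_injective {μ μ' : Measure ℝ} (h : ∀ᵐ t ∂μ, 0 < t) (h' : ∀ᵐ t ∂μ', 0 < t)
    (hmap : μ.map Real.log = μ'.map Real.log) : μ = μ' := by
  have key : ∀ ρ : Measure ℝ, (∀ᵐ t ∂ρ, 0 < t) → (ρ.map Real.log).map Real.exp = ρ := by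
    intro ρ hρ
    rw [Measure.map_map Real.measurable_exp Real.measurable_log]
    conv_rhs => rw [← Measure.map_id (μ := ρ)]
    exact Measure.map_congr (hρ.mono fun t ht => Real.exp_log ht)
  rw [← key μ h, ← key μ' h', hmap]

/-- Log-polynomials are total in the weighted `L²` space. -/
lemma ae_eq_zero_of_integral_mul_log_pow_eq_zero {a b : ℝ} (ha : -1 < a) (hb : -1 < b)
    {f : ℝ → ℝ} (hf : MemLp f 2 (logMeasure a b))
    (h : ∀ n : ℕ, ∫ t, f t * Real.log t ^ n ∂logMeasure a b = 0) :
    f =ᵐ[logMeasure a b] 0 := by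
  have := isFiniteMeasure_logMeasure ha hb
  set ν := logMeasure a b
  have hint : ∀ g : ℝ → ℝ, MemLp g 2 ν →
      Integrable (fun t => max (f t) 0 * g t) ν ∧ Integrable (fun t => max (-f t) 0 * g t) ν :=
    fun g hg => ⟨hf.pos_part.integrable_mul hg, hf.neg_part.integrable_mul hg⟩
  have hdens : ∀ g : ℝ → ℝ, AEMeasurable g ν → ∀ k : ℝ → ℝ,
      ∫ t, k t ∂ν.withDensity (fun t => ENNReal.ofReal (g t)) = ∫ t, max (g t) 0 * k t ∂ν := by
    intro g hg k
    rw [integral_withDensity_eq_integral_toReal_smul₀ hg.ennreal_ofReal (by simp)]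
    simp [ENNReal.toReal_ofReal']
  have hdensI : ∀ g : ℝ → ℝ, AEMeasurable g ν → ∀ k : ℝ → ℝ,
      Integrable (fun t => max (g t) 0 * k t) ν →
      Integrable k (ν.withDensity (fun t => ENNReal.ofReal (g t))) := by
    intro g hg k hk
    rw [integrable_withDensity_iff_integrable_smul₀' hg.ennreal_ofReal (by simp)]
    simpa [ENNReal.toReal_ofReal'] using hk
  have hfm := hf.aestronglyMeasurable.aemeasurable
  have hfin : ∀ g : ℝ → ℝ, MemLp g 2 ν →
      IsFiniteMeasure (ν.withDensity (fun t => ENNReal.ofReal (g t))) := fun g hg =>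
    isFiniteMeasure_withDensity_ofReal (hg.integrable one_le_two).hasFiniteIntegral
  have := hfin f hf
  have := hfin _ hf.neg
  have hexp : ∀ g : ℝ → ℝ, MemLp g 2 ν → (0 : ℝ) ∈ interior
      (ProbabilityTheory.integrableExpSet Real.log
        (ν.withDensity (fun t => ENNReal.ofReal (g t)))) := by
    intro g hg
    rw [mem_interior]
    -- The range of exponents is halved: the density is only in `L²`, so Cauchy–Schwarz needs `t ^
    -- (2 * s)` integrable.
    refine ⟨Ioi (-(b + 1) / 2), fun s hs => ?_, isOpen_Ioi, by rw [mem_Ioi]; linarith⟩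
    rw [mem_Ioi] at hs
    exact hdensI _ hg.aestronglyMeasurable.aemeasurable _
      (hg.pos_part.integrable_mul (memLp_exp_mul_log ha (by linarith)))
  have hpos : ∀ g : ℝ → ℝ,
      ∀ᵐ t ∂ν.withDensity (fun t => ENNReal.ofReal (g t)), 0 < t := fun g =>
    (withDensity_absolutelyContinuous _ _).ae_le ((ae_mem_Ioo_logMeasure a b).mono fun t ht => ht.1)
  -- Vanishing moments say that the positive and negative parts of `f` are densities with the same
  -- `log`-moments.
  have hmeas := map_log_injective (hpos f) (hpos (-f)) <|
    map_eq_of_integral_pow_eq Real.measurable_log (hexp f hf) (hexp _ hf.neg) fun n => by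
      rw [hdens f hfm, hdens _ hfm.neg, ← sub_eq_zero]
      refine Eq.trans ?_ (h n)
      obtain ⟨h1, h2⟩ := hint _ (memLp_log_pow ha hb n)
      simp only [Pi.neg_apply]
      rw [← integral_sub h1 h2]
      refine integral_congr_ae (.of_forall fun t => ?_)
      simp only [← sub_mul]
      rw [max_zero_sub_max_neg_zero_eq_self]
  rw [withDensity_eq_iff_of_sigmaFinite hfm.ennreal_ofReal hfm.neg.ennreal_ofReal] at hmeas
  filter_upwards [hmeas] with t ht
  rw [Pi.neg_apply] at ht
  rcases le_total (f t) 0 with h0 | h0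
  · rw [ENNReal.ofReal_of_nonpos h0, eq_comm, ENNReal.ofReal_eq_zero] at ht
    exact le_antisymm h0 (neg_nonpos.1 ht)
  · rw [ENNReal.ofReal_of_nonpos (neg_nonpos.2 h0), ENNReal.ofReal_eq_zero] at ht
    exact le_antisymm ht h0

/-! ### Integration by parts against log-polynomials. -/

open Filter Topology Polynomial

/-- Extension by zero makes `h` a genuine test function. This admits functions built from `log` and
real powers, which are smooth only inside the interval. -/
lemma HasWeakDeriv.integral_mul_deriv {v w h : ℝ → ℝ} (hv : HasWeakDeriv v w) {K : Set ℝ}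
    (hK : IsCompact K) (hKI : K ⊆ Ioo 0 1) (hh : ContDiffOn ℝ ∞ h (Ioo 0 1))
    (h0 : ∀ t ∈ Ioo (0 : ℝ) 1, t ∉ K → h t = 0) :
    ∫ t in Ioo (0 : ℝ) 1, v t * deriv h t = -∫ t in Ioo (0 : ℝ) 1, w t * h t := by
  have hzero : ∀ t, t ∉ K → (Ioo (0 : ℝ) 1).indicator h t = 0 := by
    intro t ht
    by_cases hI : t ∈ Ioo (0 : ℝ) 1
    · rw [indicator_of_mem hI, h0 t hI ht]
    · exact indicator_of_notMem hI _
  have hsupp : tsupport ((Ioo (0 : ℝ) 1).indicator h) ⊆ K :=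
    closure_minimal (fun t ht => by_contra fun hc => ht (hzero t hc)) hK.isClosed
  have heq : ∀ t ∈ Ioo (0 : ℝ) 1, (Ioo (0 : ℝ) 1).indicator h =ᶠ[𝓝 t] h := fun t ht => by
    filter_upwards [isOpen_Ioo.mem_nhds ht] with s hs using indicator_of_mem hs _
  have hsmooth : ContDiff ℝ ∞ ((Ioo (0 : ℝ) 1).indicator h) := by
    rw [contDiff_iff_contDiffAt]
    intro t
    by_cases hI : t ∈ Ioo (0 : ℝ) 1
    · exact (hh.contDiffAt (isOpen_Ioo.mem_nhds hI)).congr_of_eventuallyEq (heq t hI)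
    · refine (contDiffAt_const (c := (0 : ℝ))).congr_of_eventuallyEq ?_
      filter_upwards [hK.isClosed.isOpen_compl.mem_nhds fun hc => hI (hKI hc)] with s hs
      exact hzero s hs
  have := hv.2.2 _ hsmooth (HasCompactSupport.intro hK hzero) (hsupp.trans hKI)
  rw [setIntegral_congr_fun measurableSet_Ioo fun t ht => by rw [← (heq t ht).deriv_eq], this]
  congr 1
  exact setIntegral_congr_fun measurableSet_Ioo fun t ht => by rw [indicator_of_mem ht]

/-- The formal adjoint of `t ∂_t` on polynomials in `log t`, from the weight `(a, b)` to the
weight `(a + 1, b)`. -/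
noncomputable def logAdjoint (a b : ℝ) : ℝ[X] →ₗ[ℝ] ℝ[X] :=
  (a + 1) • LinearMap.id + (b + 1) • LinearMap.mulLeft ℝ X + LinearMap.mulLeft ℝ X ∘ₗ derivative

lemma logAdjoint_apply (a b : ℝ) (P : ℝ[X]) :
    logAdjoint a b P = (a + 1) • P + (b + 1) • (X * P) + X * derivative P := rfl

/-- `g` is `t` times the weak derivative of `f`. -/
def HasLogDeriv (f g : ℝ → ℝ) : Prop :=
  ∃ w, HasWeakDeriv f w ∧ ∀ᵐ t ∂volume.restrict (Ioo (0 : ℝ) 1), g t = t * w t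

lemma hasDerivAt_logWeight_mul_eval (a b : ℝ) (P : ℝ[X]) {t : ℝ} (ht : t ∈ Ioo (0 : ℝ) 1) :
    HasDerivAt (fun t => (-Real.log t) ^ (a + 1) * t ^ (b + 1) * P.eval (Real.log t))
      (-((-Real.log t) ^ a * t ^ b * (logAdjoint a b P).eval (Real.log t))) t := by
  have h0 : t ≠ 0 := ht.1.ne'
  have hl : 0 < -Real.log t := neg_pos.2 (Real.log_neg ht.1 ht.2)
  have hlog := Real.hasDerivAt_log h0
  have h1 := hlog.neg.rpow_const (p := a + 1) (Or.inl hl.ne')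
  have h2 := Real.hasDerivAt_rpow_const (p := b + 1) (Or.inl h0)
  have h3 := (P.hasDerivAt (Real.log t)).comp t hlog
  refine ((h1.mul h2).mul h3).congr_deriv ?_
  simp only [add_sub_cancel_right, logAdjoint_apply, Polynomial.eval_add, Polynomial.eval_mul,
    Polynomial.eval_smul, smul_eq_mul, Polynomial.eval_X, Pi.mul_apply, Function.comp_apply, Pi.neg_apply]
  rw [Real.rpow_add_one hl.ne', Real.rpow_add_one h0]
  field_simp
  ring

lemma hasDerivAt_log_neg_log {t : ℝ} (ht : t ∈ Ioo (0 : ℝ) 1) :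
    HasDerivAt (fun t => Real.log (-Real.log t)) (1 / (t * Real.log t)) t := by
  have hl := (Real.log_neg ht.1 ht.2).ne
  refine ((Real.hasDerivAt_log ht.1.ne').neg.log (neg_ne_zero.2 hl)).congr_deriv ?_
  have := ht.1.ne'
  simp only [Pi.neg_apply]
  field_simp

/-- In the variable `log (-log t)` the endpoints `0` and `1` go to `±∞`, so one rescaled bump cuts
off both. Its derivative costs `1 / (r t log t)`, whose denominator is absorbed by the extra factors
`t` and `-log t` in the weight; the error term therefore lives in the weight `(a, b)` and is of size
`1 / r`. -/
lemma HasWeakDeriv.integral_cutoff {f w : ℝ → ℝ} (hw : HasWeakDeriv f w) (a b : ℝ) (P : ℝ[X])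
    (η : ContDiffBump (0 : ℝ)) {r : ℝ} (hr : 0 < r) :
    ∫ t, (η (Real.log (-Real.log t) / r) * (f t * (logAdjoint a b P).eval (Real.log t)) +
        deriv η (Real.log (-Real.log t) / r) / r * (f t * P.eval (Real.log t))) ∂logMeasure a b =
      ∫ t, η (Real.log (-Real.log t) / r) * (t * w t * P.eval (Real.log t))
        ∂logMeasure (a + 1) b := by
  set h : ℝ → ℝ := fun t => η (Real.log (-Real.log t) / r) *
    ((-Real.log t) ^ (a + 1) * t ^ (b + 1) * P.eval (Real.log t))
  have hη : ContDiff ℝ ∞ η := η.contDiff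
  have key := hw.integral_mul_deriv (h := h)
    (K := (fun y => Real.exp (-Real.exp y)) '' Icc (-(r * η.rOut)) (r * η.rOut))
    (isCompact_Icc.image (by fun_prop)) ?_ ?_ ?_
  · rw [integral_logMeasure, integral_logMeasure, ← neg_inj]
    have e1 : ∫ t in Ioo (0 : ℝ) 1, (-Real.log t) ^ (a + 1) * t ^ b *
        (η (Real.log (-Real.log t) / r) * (t * w t * P.eval (Real.log t))) =
        ∫ t in Ioo (0 : ℝ) 1, w t * h t := by
      refine setIntegral_congr_fun measurableSet_Ioo fun t ht => ?_
      simp only [h]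
      rw [Real.rpow_add_one ht.1.ne' b]
      ring
    rw [e1, ← key, ← integral_neg]
    refine setIntegral_congr_fun measurableSet_Ioo fun t ht => ?_
    have h0 : t ≠ 0 := ht.1.ne'
    have hl : 0 < -Real.log t := neg_pos.2 (Real.log_neg ht.1 ht.2)
    have hl' : Real.log t ≠ 0 := (Real.log_neg ht.1 ht.2).ne
    have hd : HasDerivAt η (deriv η (Real.log (-Real.log t) / r)) (Real.log (-Real.log t) / r) :=
      (hη.differentiable (by simp)).differentiableAt.hasDerivAt
    have hh := (hd.comp t ((hasDerivAt_log_neg_log ht).div_const r)).mul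
      (hasDerivAt_logWeight_mul_eval a b P ht)
    have hh' : deriv h t = _ := hh.deriv
    simp only [hh', Function.comp_apply]
    rw [Real.rpow_add_one hl.ne', Real.rpow_add_one h0]
    field_simp
    ring
  · rintro _ ⟨y, _, rfl⟩
    exact ⟨Real.exp_pos _, by simpa using Real.exp_pos y⟩
  · intro t ht
    have h0 : t ≠ 0 := ht.1.ne'
    have hl : 0 < -Real.log t := neg_pos.2 (Real.log_neg ht.1 ht.2)
    have hlog : ContDiffAt ℝ ∞ Real.log t := Real.contDiffAt_log.2 h0
    refine ContDiffAt.contDiffWithinAt ?_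
    refine ((hη.contDiffAt).comp t ((hlog.neg.log hl.ne').div_const r)).mul
      (((hlog.neg.rpow_const_of_ne hl.ne').mul
        (Real.contDiffAt_rpow_const_of_ne h0)).mul ?_)
    exact (Polynomial.contDiff_aeval P ∞).contDiffAt.comp t hlog
  · intro t ht htK
    have hl : 0 < -Real.log t := neg_pos.2 (Real.log_neg ht.1 ht.2)
    have : η (Real.log (-Real.log t) / r) = 0 := by
      refine η.zero_of_le_dist ?_
      by_contra! hc
      refine htK ⟨Real.log (-Real.log t), ?_, by
        simp only [Real.exp_log hl, neg_neg, Real.exp_log ht.1]⟩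
      rw [Real.dist_eq, sub_zero, abs_div, abs_of_pos hr, div_lt_iff₀ hr, mul_comm] at hc
      exact ⟨(abs_lt.1 hc).1.le, (abs_lt.1 hc).2.le⟩
    simp only [h, this, zero_mul]

/-- Integration by parts against log-polynomials. -/
lemma HasLogDeriv.integral_mul_eval {f g : ℝ → ℝ} (hfg : HasLogDeriv f g) {a b : ℝ}
    (ha : -1 < a) (hb : -1 < b) (hf : MemLp f 2 (logMeasure a b))
    (hg : MemLp g 2 (logMeasure (a + 1) b)) (P : ℝ[X]) :
    ∫ t, g t * P.eval (Real.log t) ∂logMeasure (a + 1) b =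
      ∫ t, f t * (logAdjoint a b P).eval (Real.log t) ∂logMeasure a b := by
  obtain ⟨w, hw, hgw⟩ := hfg
  rw [← ae_logMeasure (a + 1) b] at hgw
  let η : ContDiffBump (0 : ℝ) := ⟨1, 2, one_pos, one_lt_two⟩
  have hη : ContDiff ℝ ∞ η := η.contDiff
  have hη' : Continuous (deriv η) := hη.continuous_deriv (by simp)
  have hηm : ∀ r : ℝ, Measurable fun t => η (Real.log (-Real.log t) / r) := fun r =>
    η.continuous.measurable.comp (by fun_prop)
  have hη'm : ∀ r : ℝ, Measurable fun t => deriv η (Real.log (-Real.log t) / r) / r := fun r =>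
    (hη'.measurable.comp (by fun_prop)).div_const r
  obtain ⟨M, hM⟩ := η.hasCompactSupport.deriv.exists_bound_of_continuous hη'
  have hlim : Tendsto (fun n : ℕ => (n : ℝ) + 1) atTop atTop :=
    tendsto_atTop_add_const_right _ _ tendsto_natCast_atTop_atTop
  have hη1 : ∀ y : ℝ, Tendsto (fun n : ℕ => η (y / ((n : ℝ) + 1))) atTop (𝓝 1) := by
    intro y
    have h1 : η 0 = 1 := η.one_of_mem_closedBall (Metric.mem_closedBall_self one_pos.le)
    have h2 := (η.continuous.tendsto 0).comp (hlim.const_div_atTop y)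
    rwa [h1] at h2
  have hη2 : ∀ y : ℝ, Tendsto (fun n : ℕ => deriv η (y / ((n : ℝ) + 1)) / ((n : ℝ) + 1))
      atTop (𝓝 0) := by
    intro y
    have := ((hη'.tendsto 0).comp (hlim.const_div_atTop y)).mul (hlim.const_div_atTop 1)
    simpa [Function.comp_def, div_eq_mul_inv] using this
  have hηb : ∀ y, |η y| ≤ 1 := fun y => by
    rw [abs_of_nonneg η.nonneg]; exact η.le_one
  have hi1 : Integrable (fun t => f t * (logAdjoint a b P).eval (Real.log t)) (logMeasure a b) :=
    hf.integrable_mul (memLp_polynomial_log ha hb _)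
  have hi2 : Integrable (fun t => f t * P.eval (Real.log t)) (logMeasure a b) :=
    hf.integrable_mul (memLp_polynomial_log ha hb _)
  have hi3 : Integrable (fun t => g t * P.eval (Real.log t)) (logMeasure (a + 1) b) :=
    hg.integrable_mul (memLp_polynomial_log (by linarith) hb _)
  have hL : Tendsto (fun n : ℕ => ∫ t, η (Real.log (-Real.log t) / ((n : ℝ) + 1)) *
      (g t * P.eval (Real.log t)) ∂logMeasure (a + 1) b) atTop
      (𝓝 (∫ t, g t * P.eval (Real.log t) ∂logMeasure (a + 1) b)) := by
    refine tendsto_integral_of_dominated_convergence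
      (fun t => ‖g t * P.eval (Real.log t)‖) (fun n => ?_) hi3.norm (fun n => ?_) ?_
    · exact (hηm _).aestronglyMeasurable.mul hi3.aestronglyMeasurable
    · refine .of_forall fun t => ?_
      rw [norm_mul]
      exact mul_le_of_le_one_left (norm_nonneg _) (hηb _)
    · refine .of_forall fun t => ?_
      simpa using (hη1 (Real.log (-Real.log t))).mul_const (g t * P.eval (Real.log t))
  have hR : Tendsto (fun n : ℕ => ∫ t, (η (Real.log (-Real.log t) / ((n : ℝ) + 1)) *
        (f t * (logAdjoint a b P).eval (Real.log t)) +
        deriv η (Real.log (-Real.log t) / ((n : ℝ) + 1)) / ((n : ℝ) + 1) *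
        (f t * P.eval (Real.log t))) ∂logMeasure a b) atTop
      (𝓝 (∫ t, f t * (logAdjoint a b P).eval (Real.log t) ∂logMeasure a b)) := by
    refine tendsto_integral_of_dominated_convergence
      (fun t => ‖f t * (logAdjoint a b P).eval (Real.log t)‖ + M * ‖f t * P.eval (Real.log t)‖)
      (fun n => ?_) (hi1.norm.add (hi2.norm.const_mul M)) (fun n => ?_) ?_
    · exact ((hηm _).aestronglyMeasurable.mul hi1.aestronglyMeasurable).add
        ((hη'm _).aestronglyMeasurable.mul hi2.aestronglyMeasurable)
    · refine .of_forall fun t => (norm_add_le _ _).trans (add_le_add ?_ ?_)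
      · rw [norm_mul]
        exact mul_le_of_le_one_left (norm_nonneg _) (hηb _)
      · rw [norm_mul]
        refine mul_le_mul_of_nonneg_right ?_ (norm_nonneg _)
        rw [norm_div]
        refine (div_le_self (norm_nonneg _) ?_).trans (hM _)
        rw [Real.norm_of_nonneg (by positivity)]
        linarith [n.cast_nonneg (α := ℝ)]
    · refine .of_forall fun t => ?_
      simpa using ((hη1 (Real.log (-Real.log t))).mul_const
        (f t * (logAdjoint a b P).eval (Real.log t))).add
        ((hη2 (Real.log (-Real.log t))).mul_const (f t * P.eval (Real.log t)))
  -- The cutoff identity holds at each scale `r = n + 1`; both sides converge by dominated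
  -- convergence, with no boundary values of `f`.
  refine tendsto_nhds_unique hL (hR.congr fun n => ?_)
  rw [hw.integral_cutoff a b P η (by positivity)]
  refine integral_congr_ae ?_
  filter_upwards [hgw] with t ht
  rw [ht]

/-! ### Calculus of weak derivatives. -/

lemma hasWeakDeriv_of_hasDerivAt {v w : ℝ → ℝ} (hv : ∀ t ∈ Ioo (0 : ℝ) 1, HasDerivAt v (w t) t)
    (hw : ContinuousOn w (Ioo 0 1)) : HasWeakDeriv v w := by
  have hvc : ContinuousOn v (Ioo 0 1) := fun t ht => (hv t ht).continuousAt.continuousWithinAt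
  refine ⟨hvc.locallyIntegrableOn measurableSet_Ioo, hw.locallyIntegrableOn measurableSet_Ioo,
    fun φ hφ hφc hφs => ?_⟩
  have hφd : Differentiable ℝ φ := hφ.differentiable (by simp)
  have hφ' : Continuous (deriv φ) := hφ.continuous_deriv (by simp)
  have hs' : tsupport (deriv φ) ⊆ Ioo 0 1 := tsupport_deriv_subset.trans hφs
  have hc : ∀ ψ u : ℝ → ℝ, Continuous ψ → tsupport ψ ⊆ Ioo 0 1 → HasCompactSupport ψ →
      ContinuousOn u (Ioo 0 1) → Integrable (fun t => u t * ψ t) := by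
    intro ψ u hψ hψs hψc hu
    refine Continuous.integrable_of_hasCompactSupport ?_ hψc.mul_left
    exact (hu.mul hψ.continuousOn).continuous_of_tsupport_subset isOpen_Ioo
      ((tsupport_mul_subset_right).trans hψs)
  have hi1 := hc _ _ hφ' hs' hφc.deriv hvc
  have hi2 := hc _ _ hφ.continuous hφs hφc hw
  have hz : ∀ ψ u : ℝ → ℝ, tsupport ψ ⊆ Ioo 0 1 →
      ∫ t in Ioo (0 : ℝ) 1, u t * ψ t = ∫ t, u t * ψ t := fun ψ u hψs =>
    setIntegral_eq_integral_of_forall_compl_eq_zero fun t ht => by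
      rw [image_eq_zero_of_notMem_tsupport fun hc => ht (hψs hc), mul_zero]
  rw [hz _ _ hs', hz _ _ hφs, eq_neg_iff_add_eq_zero, ← integral_add hi1 hi2]
  refine integral_eq_zero_of_hasDerivAt_of_integrable (f := fun t => v t * φ t) (fun t => ?_)
    (hi1.add hi2) (hc _ _ hφ.continuous hφs hφc hvc)
  by_cases ht : t ∈ Ioo (0 : ℝ) 1
  · exact ((hv t ht).mul (hφd t).hasDerivAt).congr_deriv (by ring)
  · have h1 : t ∉ tsupport φ := fun hc => ht (hφs hc)
    have h2 : t ∉ tsupport (deriv φ) := fun hc => ht (hs' hc)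
    rw [image_eq_zero_of_notMem_tsupport h1, image_eq_zero_of_notMem_tsupport h2]
    refine ((hasDerivAt_const t (0 : ℝ)).congr_of_eventuallyEq ?_).congr_deriv (by simp)
    filter_upwards [(isClosed_tsupport φ).isOpen_compl.mem_nhds h1] with s hs
    rw [image_eq_zero_of_notMem_tsupport hs, mul_zero]

lemma hasLogDeriv_polynomial_log (P : ℝ[X]) :
    HasLogDeriv (fun t => P.eval (Real.log t)) (fun t => (derivative P).eval (Real.log t)) := by
  have hc : ContinuousOn Real.log (Ioo 0 1) :=
    Real.continuousOn_log.mono fun t ht => ht.1.ne'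
  refine ⟨fun t => (derivative P).eval (Real.log t) * t⁻¹,
    hasWeakDeriv_of_hasDerivAt (fun t ht => ?_) ?_, ?_⟩
  · exact (P.hasDerivAt _).comp t (Real.hasDerivAt_log ht.1.ne')
  · exact ((derivative P).continuous.comp_continuousOn hc).mul
      (continuousOn_id.inv₀ fun t ht => ht.1.ne')
  · filter_upwards [ae_restrict_mem measurableSet_Ioo] with t ht
    have := ht.1.ne'
    field_simp

lemma HasLogDeriv.sub {f₁ g₁ f₂ g₂ : ℝ → ℝ} (h₁ : HasLogDeriv f₁ g₁) (h₂ : HasLogDeriv f₂ g₂) :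
    HasLogDeriv (fun t => f₁ t - f₂ t) (fun t => g₁ t - g₂ t) := by
  obtain ⟨w₁, hw₁, hg₁⟩ := h₁
  obtain ⟨w₂, hw₂, hg₂⟩ := h₂
  refine ⟨fun t => w₁ t - w₂ t, ⟨hw₁.1.sub hw₂.1, hw₁.2.1.sub hw₂.2.1, fun φ hφ hφc hφs => ?_⟩, ?_⟩
  · have hi : ∀ ψ u : ℝ → ℝ, Continuous ψ → tsupport ψ ⊆ Ioo 0 1 → HasCompactSupport ψ →
        LocallyIntegrableOn u (Ioo 0 1) → IntegrableOn (fun t => u t * ψ t) (Ioo 0 1) := by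
      intro ψ u hψ hψs hψc hu
      have h1 : IntegrableOn u (tsupport ψ) := hu.integrableOn_compact_subset hψs hψc
      have h2 : IntegrableOn (fun t => u t * ψ t) (tsupport ψ) :=
        h1.mul_continuousOn hψ.continuousOn hψc
      refine (IntegrableOn.of_forall_sdiff_eq_zero h2 measurableSet_Ioo fun t ht => ?_)
      rw [image_eq_zero_of_notMem_tsupport ht.2, mul_zero]
    have hφ' : Continuous (deriv φ) := hφ.continuous_deriv (by simp)
    have hs' : tsupport (deriv φ) ⊆ Ioo 0 1 := tsupport_deriv_subset.trans hφs
    simp only [sub_mul]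
    rw [integral_sub (hi _ _ hφ' hs' hφc.deriv hw₁.1) (hi _ _ hφ' hs' hφc.deriv hw₂.1),
      integral_sub (hi _ _ hφ.continuous hφs hφc hw₁.2.1)
        (hi _ _ hφ.continuous hφs hφc hw₂.2.1),
      hw₁.2.2 φ hφ hφc hφs, hw₂.2.2 φ hφ hφc hφs]
    ring
  · filter_upwards [hg₁, hg₂] with t h1 h2
    rw [h1, h2]
    ring

lemma HasWeakDeriv.congr_left {v v' w : ℝ → ℝ} (h : HasWeakDeriv v w)
    (hv : v =ᵐ[volume.restrict (Ioo (0 : ℝ) 1)] v') : HasWeakDeriv v' w := by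
  refine ⟨?_, h.2.1, fun φ hφ hφc hφs => ?_⟩
  · intro x hx
    obtain ⟨s, hs, hi⟩ := h.1 x hx
    refine ⟨s ∩ Ioo 0 1, inter_mem hs self_mem_nhdsWithin,
      (hi.mono_set inter_subset_left).congr ?_⟩
    exact ae_restrict_of_ae_restrict_of_subset inter_subset_right hv
  · rw [← h.2.2 φ hφ hφc hφs]
    refine integral_congr_ae ?_
    filter_upwards [hv] with t ht
    rw [ht]

/-- Subtracting the two relations makes the difference a weak derivative of `0`, to which the
fundamental lemma of the calculus of variations applies. Uniqueness is what makes the chosen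
`weakDeriv` computable almost everywhere. -/
lemma HasWeakDeriv.ae_unique {v w w' : ℝ → ℝ} (h : HasWeakDeriv v w) (h' : HasWeakDeriv v w') :
    w =ᵐ[volume.restrict (Ioo (0 : ℝ) 1)] w' := by
  have key : HasLogDeriv (fun _ => 0) (fun t => t * w t - t * w' t) := by
    have := HasLogDeriv.sub (f₁ := v) (f₂ := v) (g₁ := fun t => t * w t) (g₂ := fun t => t * w' t)
      ⟨w, h, .of_forall fun _ => rfl⟩ ⟨w', h', .of_forall fun _ => rfl⟩
    simpa using this
  obtain ⟨d, hd, hdw⟩ := key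
  have hd0 := isOpen_Ioo.ae_eq_zero_of_integral_contDiff_smul_eq_zero hd.2.1 fun φ hφ hφc hφs => by
    have h1 := hd.2.2 φ hφ hφc hφs
    simp only [zero_mul, integral_zero, zero_eq_neg] at h1
    rw [← h1, setIntegral_eq_integral_of_forall_compl_eq_zero fun t ht => by
      rw [image_eq_zero_of_notMem_tsupport fun hc => ht (hφs hc), mul_zero]]
    simp [mul_comm]
  rw [← ae_restrict_iff' measurableSet_Ioo] at hd0
  filter_upwards [hd0, hdw, ae_restrict_mem measurableSet_Ioo] with t h0 h1 ht
  rw [h0, mul_zero, ← mul_sub] at h1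
  exact sub_eq_zero.1 ((mul_eq_zero.1 h1).resolve_left ht.1.ne')

lemma WeaklyDifferentiable.hasWeakDeriv {v : ℝ → ℝ} (h : WeaklyDifferentiable v) :
    HasWeakDeriv v (weakDeriv v) := by
  rw [weakDeriv, dif_pos h]
  exact h.choose_spec

lemma HasLogDeriv.weaklyDifferentiable {f g : ℝ → ℝ} (h : HasLogDeriv f g) :
    WeaklyDifferentiable f :=
  h.imp fun _ hw => hw.1

lemma HasLogDeriv.congr_left {f f' g : ℝ → ℝ} (h : HasLogDeriv f g)
    (hf : f =ᵐ[volume.restrict (Ioo (0 : ℝ) 1)] f') : HasLogDeriv f' g :=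
  h.imp fun _ hw => ⟨hw.1.congr_left hf, hw.2⟩

lemma HasLogDeriv.ae_eq_mul_weakDeriv {f g : ℝ → ℝ} (h : HasLogDeriv f g) :
    g =ᵐ[volume.restrict (Ioo (0 : ℝ) 1)] fun t => t * weakDeriv f t := by
  obtain ⟨w, hw, hg⟩ := h
  have hu : WeaklyDifferentiable f := ⟨w, hw⟩
  filter_upwards [hg, hw.ae_unique hu.hasWeakDeriv] with t h1 h2
  rw [h1, h2]

/-! ### An abstract spectral inequality for degree-triangular operators. -/

section Hilbert

variable {H₁ H₂ : Type*} [NormedAddCommGroup H₁] [InnerProductSpace ℝ H₁]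
  [NormedAddCommGroup H₂] [InnerProductSpace ℝ H₂]

/-- The image of `degreeLT` is finite-dimensional, so the orthogonal projection exists without
completeness of `H₁`. -/
lemma exists_mem_degreeLT_inner_sub_eq_zero (ι : ℝ[X] →ₗ[ℝ] H₁) (M : ℕ) (x : H₁) :
    ∃ p ∈ degreeLT ℝ M, ∀ Q ∈ degreeLT ℝ M, inner ℝ (x - ι p) (ι Q) = 0 := by
  have : FiniteDimensional ℝ (degreeLT ℝ M) :=
    (degreeLTEquiv ℝ M).symm.finiteDimensional
  let K := (degreeLT ℝ M).map ι
  obtain ⟨p, hp, hpx⟩ := K.starProjection_apply_mem x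
  refine ⟨p, hp, fun Q hQ => ?_⟩
  rw [hpx]
  exact K.starProjection_inner_eq_zero x _ (Submodule.mem_map_of_mem hQ)

variable {ι : ℝ[X] →ₗ[ℝ] H₁} {δ : ℝ[X] →ₗ[ℝ] H₂} {T : ℝ[X] →ₗ[ℝ] ℝ[X]} {c : ℝ}

lemma map_mem_degreeLT (hT : ∀ n : ℕ, ∀ P ∈ degreeLT ℝ (n + 1), T P - (c * n) • P ∈ degreeLT ℝ n)
    {n : ℕ} {P : ℝ[X]} (hP : P ∈ degreeLT ℝ n) : T P ∈ degreeLT ℝ n := by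
  cases n with
  | zero =>
    have : P = 0 := by simpa [mem_degreeLT] using hP
    simp [this]
  | succ n =>
    rw [← sub_add_cancel (T P) ((c * n) • P)]
    exact add_mem (degreeLT_mono n.le_succ (hT n P hP)) (Submodule.smul_mem _ _ hP)

/-- Polynomial case of the spectral inequality for an operator triangular on degrees. -/
lemma mul_norm_sq_le_of_mem_degreeLT (hc : 0 ≤ c)
    (hT : ∀ n : ℕ, ∀ P ∈ degreeLT ℝ (n + 1), T P - (c * n) • P ∈ degreeLT ℝ n)
    (hδ : ∀ P Q, inner ℝ (δ P) (δ Q) = inner ℝ (ι P) (ι (T Q))) (n M : ℕ) :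
    ∀ P ∈ degreeLT ℝ M, (∀ Q ∈ degreeLT ℝ n, inner ℝ (ι P) (ι Q) = 0) →
      c * n * ‖ι P‖ ^ 2 ≤ ‖δ P‖ ^ 2 := by
  induction M with
  | zero =>
    intro P hP _
    have : P = 0 := by simpa [mem_degreeLT] using hP
    simp [this]
  | succ M ih =>
    intro P hP hPn
    rcases le_or_gt (M + 1) n with h | h
    · have h0 : inner ℝ (ι P) (ι P) = 0 := hPn P (degreeLT_mono h hP)
      rw [← real_inner_self_eq_norm_sq, h0, mul_zero]
      positivity
    -- Gram–Schmidt: `l = P - r` is the top-degree component. Since `T` preserves degrees, `l` and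
    -- `r` are orthogonal for both quadratic forms, and the diagonal entry of `T` gives `‖δ l‖² = c
    -- M ‖ι l‖²`.
    obtain ⟨r, hr, hrP⟩ := exists_mem_degreeLT_inner_sub_eq_zero ι M (ι P)
    rw [← map_sub] at hrP
    set l := P - r
    have hl : l ∈ degreeLT ℝ (M + 1) := sub_mem hP (degreeLT_mono M.le_succ hr)
    have hPl : P = l + r := (sub_add_cancel P r).symm
    have hrn : ∀ Q ∈ degreeLT ℝ n, inner ℝ (ι r) (ι Q) = 0 := by
      intro Q hQ
      have h1 := hPn Q hQ
      rw [hPl, map_add, inner_add_left, hrP Q (degreeLT_mono (by omega) hQ), zero_add] at h1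
      exact h1
    have h1 := ih r hr hrn
    have h2 : ‖ι P‖ ^ 2 = ‖ι l‖ ^ 2 + ‖ι r‖ ^ 2 := by
      rw [hPl, map_add, norm_add_sq_real, hrP r hr]
      ring
    have h3 : ‖δ P‖ ^ 2 = ‖δ l‖ ^ 2 + ‖δ r‖ ^ 2 := by
      rw [hPl, map_add, norm_add_sq_real, hδ, hrP _ (map_mem_degreeLT hT hr)]
      ring
    have h4 : ‖δ l‖ ^ 2 = c * M * ‖ι l‖ ^ 2 := by
      have h5 := hrP _ (hT M l hl)
      rw [map_sub ι (T l), inner_sub_right, map_smul, inner_smul_right, ← hδ, real_inner_self_eq_norm_sq,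
        real_inner_self_eq_norm_sq] at h5
      linarith
    have h6 : c * n * ‖ι l‖ ^ 2 ≤ c * M * ‖ι l‖ ^ 2 := by
      have : (n : ℝ) ≤ M := by exact_mod_cast Nat.lt_succ_iff.1 h
      gcongr
    rw [h2, h3, h4]
    linarith

/-- A vector orthogonal to all polynomials of degree `< n` satisfies the spectral inequality with
constant `c n`, provided the polynomials are total. -/
lemma mul_norm_sq_le_of_orthogonal [CompleteSpace H₁] (hc : 0 ≤ c)
    (hT : ∀ n : ℕ, ∀ P ∈ degreeLT ℝ (n + 1), T P - (c * n) • P ∈ degreeLT ℝ n)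
    (hδ : ∀ P Q, inner ℝ (δ P) (δ Q) = inner ℝ (ι P) (ι (T Q)))
    (hι : ∀ x : H₁, (∀ P, inner ℝ (ι P) x = 0) → x = 0) {e : H₁} {g : H₂}
    (heg : ∀ P, inner ℝ g (δ P) = inner ℝ e (ι (T P))) {n : ℕ}
    (hen : ∀ Q ∈ degreeLT ℝ n, inner ℝ e (ι Q) = 0) :
    c * n * ‖e‖ ^ 2 ≤ ‖g‖ ^ 2 := by
  have hdense : e ∈ closure (range ι) := by
    have : (LinearMap.range ι).topologicalClosure = ⊤ := by
      rw [Submodule.topologicalClosure_eq_top_iff, Submodule.eq_bot_iff]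
      intro x hx
      exact hι x fun P => hx _ ⟨P, rfl⟩
    have h2 : e ∈ (LinearMap.range ι).topologicalClosure := this ▸ Submodule.mem_top
    rwa [← SetLike.mem_coe, Submodule.topologicalClosure_coe, LinearMap.coe_range] at h2
  -- A closed condition that becomes the claim at `x = e`; it therefore suffices to check it on the
  -- dense range of `ι`.
  have hclosed : IsClosed {x : H₁ | c * n * (‖e‖ ^ 2 - ‖e - x‖ ^ 2) ≤ ‖g‖ ^ 2} :=
    isClosed_le (by fun_prop) continuous_const
  have hsub : range ι ⊆ {x : H₁ | c * n * (‖e‖ ^ 2 - ‖e - x‖ ^ 2) ≤ ‖g‖ ^ 2} := by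
    rintro _ ⟨P, rfl⟩
    set M := max n (P.natDegree + 1)
    have hPM : P ∈ degreeLT ℝ M := by
      rw [mem_degreeLT]
      refine P.degree_le_natDegree.trans_lt ?_
      exact_mod_cast (Nat.lt_succ_self _).trans_le (le_max_right _ _)
    obtain ⟨p, hp, hpe⟩ := exists_mem_degreeLT_inner_sub_eq_zero ι M e
    have hpn : ∀ Q ∈ degreeLT ℝ n, inner ℝ (ι p) (ι Q) = 0 := by
      intro Q hQ
      have h1 := hpe Q (degreeLT_mono (le_max_left _ _) hQ)
      rw [inner_sub_left, hen Q hQ] at h1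
      linarith
    -- The projection `p` of `e` inherits the orthogonality, because `M ≥ n`.
    have h1 := mul_norm_sq_le_of_mem_degreeLT hc hT hδ n M p hp hpn
    have h2 : ‖δ p‖ ≤ ‖g‖ := by
      -- As `T p` has degree below `M`, `p` may be replaced by `e` in `⟨ι p, ι (T p)⟩`. This Bessel
      -- bound needs no density of the range of `δ`.
      have h3 : ‖δ p‖ ^ 2 = inner ℝ g (δ p) := by
        have h4 := hpe _ (map_mem_degreeLT hT hp)
        rw [inner_sub_left, ← hδ, ← heg, real_inner_self_eq_norm_sq] at h4
        linarith
      have h5 := real_inner_le_norm g (δ p)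
      rcases (norm_nonneg (δ p)).eq_or_lt with h0 | h0
      · rw [← h0]
        exact norm_nonneg g
      · nlinarith
    have h3 : ‖e‖ ^ 2 = ‖e - ι p‖ ^ 2 + ‖ι p‖ ^ 2 := by
      conv_lhs => rw [← sub_add_cancel e (ι p)]
      rw [norm_add_sq_real, hpe p hp]
      ring
    have h4 : ‖e - ι P‖ ^ 2 = ‖e - ι p‖ ^ 2 + ‖ι (p - P)‖ ^ 2 := by
      have h5 : e - ι P = (e - ι p) + ι (p - P) := by
        rw [map_sub]
        abel
      rw [h5, norm_add_sq_real, hpe _ (sub_mem hp hPM)]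
      ring
    have h5 : ‖e‖ ^ 2 - ‖e - ι P‖ ^ 2 ≤ ‖ι p‖ ^ 2 := by
      rw [h3, h4]
      nlinarith [sq_nonneg ‖ι (p - P)‖]
    calc c * n * (‖e‖ ^ 2 - ‖e - ι P‖ ^ 2) ≤ c * n * ‖ι p‖ ^ 2 := by gcongr
      _ ≤ ‖δ p‖ ^ 2 := h1
      _ ≤ ‖g‖ ^ 2 := by gcongr
  have := closure_minimal hsub hclosed hdense
  simpa using this

end Hilbert

/-! ### The weighted Poincaré inequality. -/

lemma inner_toLp {μ : Measure ℝ} {f g : ℝ → ℝ} (hf : MemLp f 2 μ) (hg : MemLp g 2 μ) :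
    inner ℝ (hf.toLp f) (hg.toLp g) = ∫ t, f t * g t ∂μ := by
  rw [L2.inner_def]
  refine integral_congr_ae ?_
  filter_upwards [hf.coeFn_toLp, hg.coeFn_toLp] with t h1 h2
  rw [h1, h2]
  simp [mul_comm]

/-- Log-polynomials as elements of the weighted `L²` space. -/
noncomputable def logPolyLp {a b : ℝ} (ha : -1 < a) (hb : -1 < b) :
    ℝ[X] →ₗ[ℝ] Lp ℝ 2 (logMeasure a b) where
  toFun P := (memLp_polynomial_log ha hb P).toLp
  map_add' P Q := by
    rw [← MemLp.toLp_add]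
    exact MemLp.toLp_congr _ _ (.of_forall fun t => by simp)
  map_smul' r P := by
    rw [RingHom.id_apply, ← MemLp.toLp_const_smul]
    exact MemLp.toLp_congr _ _ (.of_forall fun t => by simp)

lemma logPolyLp_apply {a b : ℝ} (ha : -1 < a) (hb : -1 < b) (P : ℝ[X]) :
    logPolyLp ha hb P = (memLp_polynomial_log ha hb P).toLp := rfl

lemma mem_degreeLT_iff_coeff {n : ℕ} {P : ℝ[X]} :
    P ∈ degreeLT ℝ n ↔ ∀ k, n ≤ k → P.coeff k = 0 := by
  rw [mem_degreeLT, degree_lt_iff_coeff_zero]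

lemma derivative_mem_degreeLT {n : ℕ} {P : ℝ[X]} (hP : P ∈ degreeLT ℝ (n + 1)) :
    derivative P ∈ degreeLT ℝ n := by
  rw [mem_degreeLT_iff_coeff] at *
  intro k hk
  rw [coeff_derivative, hP (k + 1) (by omega), zero_mul]

lemma coeff_logAdjoint (a b : ℝ) (P : ℝ[X]) (k : ℕ) :
    (logAdjoint a b P).coeff k =
      (a + 1 + k) * P.coeff k + (b + 1) * (X * P).coeff k := by
  rw [logAdjoint_apply]
  cases k with
  | zero => simp
  | succ k =>
    simp only [coeff_add, coeff_smul, coeff_X_mul, coeff_derivative, smul_eq_mul]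
    push_cast
    ring

lemma logAdjoint_mem_degreeLT (a b : ℝ) {n : ℕ} {P : ℝ[X]} (hP : P ∈ degreeLT ℝ n) :
    logAdjoint a b P ∈ degreeLT ℝ (n + 1) := by
  rw [mem_degreeLT_iff_coeff] at *
  intro k hk
  obtain ⟨k, rfl⟩ : ∃ j, k = j + 1 := ⟨k - 1, by omega⟩
  rw [coeff_logAdjoint, coeff_X_mul, hP _ (by omega), hP _ (by omega)]
  ring

/-- Only the term `(b + 1) X P'` keeps the top degree, and it multiplies the leading coefficient by
`(b + 1) n`. -/
lemma logAdjoint_derivative_sub_mem_degreeLT (a b : ℝ) (n : ℕ) {P : ℝ[X]}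
    (hP : P ∈ degreeLT ℝ (n + 1)) :
    (logAdjoint a b ∘ₗ derivative) P - ((b + 1) * n) • P ∈ degreeLT ℝ n := by
  rw [mem_degreeLT_iff_coeff] at *
  intro k hk
  rw [LinearMap.comp_apply, coeff_sub, coeff_logAdjoint, coeff_derivative, coeff_smul,
    hP (k + 1) (by omega)]
  rcases hk.eq_or_lt with rfl | hk
  · cases n with
    | zero => simp
    | succ n =>
      rw [coeff_X_mul, coeff_derivative]
      push_cast
      simp only [smul_eq_mul]
      ring
  · obtain ⟨k, rfl⟩ : ∃ j, k = j + 1 := ⟨k - 1, by omega⟩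
    rw [coeff_X_mul, coeff_derivative, hP (k + 1) hk]
    simp

/-- The sharp weighted Poincaré inequality: a function orthogonal to the log-polynomials of
degree `< n` is controlled by its logarithmic derivative. -/
lemma HasLogDeriv.mul_eLpNorm_sq_le {e g : ℝ → ℝ} (heg : HasLogDeriv e g) {a b : ℝ}
    (ha : -1 < a) (hb : -1 < b) (he : MemLp e 2 (logMeasure a b))
    (hg : MemLp g 2 (logMeasure (a + 1) b)) {n : ℕ}
    (hn : ∀ Q ∈ degreeLT ℝ n, ∫ t, e t * Q.eval (Real.log t) ∂logMeasure a b = 0) :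
    (b + 1) * n * (eLpNorm e 2 (logMeasure a b)).toReal ^ 2 ≤
      (eLpNorm g 2 (logMeasure (a + 1) b)).toReal ^ 2 := by
  have ha' : -1 < a + 1 := by linarith
  rw [← Lp.norm_toLp e he, ← Lp.norm_toLp g hg]
  refine mul_norm_sq_le_of_orthogonal (ι := logPolyLp ha hb) (δ := logPolyLp ha' hb ∘ₗ derivative)
    (T := logAdjoint a b ∘ₗ derivative) (by linarith)
    (fun n P hP => logAdjoint_derivative_sub_mem_degreeLT a b n hP) (fun P Q => ?_) (fun x hx => ?_)
    (fun P => ?_) (fun Q hQ => ?_)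
  · simp only [LinearMap.comp_apply, logPolyLp_apply, inner_toLp]
    exact (hasLogDeriv_polynomial_log P).integral_mul_eval ha hb (memLp_polynomial_log ha hb _)
      (memLp_polynomial_log ha' hb _) _
  · rw [Lp.eq_zero_iff_ae_eq_zero]
    refine ae_eq_zero_of_integral_mul_log_pow_eq_zero ha hb (Lp.memLp x) fun n => ?_
    rw [← hx (X ^ n), logPolyLp_apply]
    conv_rhs => rw [← Lp.toLp_coeFn x (Lp.memLp x)]
    rw [inner_toLp]
    simp [mul_comm]
  · simp only [LinearMap.comp_apply, logPolyLp_apply, inner_toLp]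
    exact heg.integral_mul_eval ha hb he hg _
  · rw [logPolyLp_apply, inner_toLp]
    exact hn Q hQ

/-- A nonzero polynomial in `log t` has finitely many zeros in the interval, hence cannot vanish
almost everywhere. -/
lemma logPolyLp_injective {a b : ℝ} (ha : -1 < a) (hb : -1 < b) :
    Function.Injective (logPolyLp ha hb) := by
  rw [injective_iff_map_eq_zero]
  intro P hP
  by_contra hP0
  have hP := (memLp_polynomial_log ha hb P).coeFn_toLp.symm.trans
    ((Lp.eq_zero_iff_ae_eq_zero (f := logPolyLp ha hb P)).1 hP)
  rw [EventuallyEq, ae_logMeasure] at hP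
  have hfin : {t : ℝ | t ∈ Ioo (0 : ℝ) 1 ∧ P.eval (Real.log t) = 0}.Finite := by
    refine ((P.rootSet_finite ℝ).image Real.exp).subset fun t ht => ?_
    exact ⟨Real.log t, by simpa [mem_rootSet, hP0] using ht.2, Real.exp_log ht.1.1⟩
  have h1 : ∀ᵐ t ∂volume.restrict (Ioo (0 : ℝ) 1),
      t ∉ {t : ℝ | t ∈ Ioo (0 : ℝ) 1 ∧ P.eval (Real.log t) = 0} :=
    ae_restrict_of_ae (measure_eq_zero_iff_ae_notMem.1 (hfin.measure_zero _))
  have h2 : ∀ᵐ t ∂volume.restrict (Ioo (0 : ℝ) 1), False := by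
    filter_upwards [h1, hP, ae_restrict_mem measurableSet_Ioo] with t h h' ht
    exact h ⟨ht, h'⟩
  rw [ae_iff] at h2
  simp at h2

/-! ### The projection onto log-polynomials. -/

lemma mem_logPoly_iff {N : ℕ} {q : ℝ → ℝ} :
    q ∈ logPoly N ↔ ∃ Q ∈ degreeLT ℝ (N + 1), q = fun t => Q.eval (Real.log t) := by
  constructor
  · intro hq
    induction hq using Submodule.span_induction with
    | mem f hf =>
      obtain ⟨j, hj, rfl⟩ := hf
      refine ⟨X ^ j, ?_, by simp⟩
      rw [mem_degreeLT, degree_X_pow]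
      exact_mod_cast Nat.lt_succ_of_le hj
    | zero => exact ⟨0, zero_mem _, by ext; simp⟩
    | add f g _ _ hf hg =>
      obtain ⟨P, hP, rfl⟩ := hf
      obtain ⟨Q, hQ, rfl⟩ := hg
      exact ⟨P + Q, add_mem hP hQ, by ext; simp⟩
    | smul r f _ hf =>
      obtain ⟨P, hP, rfl⟩ := hf
      exact ⟨r • P, Submodule.smul_mem _ _ hP, by ext; simp⟩
  · rintro ⟨Q, hQ, rfl⟩
    have : (fun t => Q.eval (Real.log t)) =
        ∑ i ∈ Finset.range (N + 1), Q.coeff i • fun t => Real.log t ^ i := by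
      ext t
      rw [eval_eq_sum_range' (n := N + 1)]
      · simp [Finset.sum_apply]
      · rw [Nat.lt_succ_iff, natDegree_le_iff_coeff_eq_zero]
        intro k hk
        exact mem_degreeLT_iff_coeff.1 hQ k hk
    rw [this]
    exact Submodule.sum_mem _ fun i hi => Submodule.smul_mem _ _ <| Submodule.subset_span
      ⟨i, Nat.lt_succ_iff.1 (Finset.mem_range.1 hi), rfl⟩

/-- Injectivity into `L²` makes the polynomial itself unique, so the projection is unique as a
function and not merely almost everywhere. -/
lemma existsUnique_degreeLT_projection {a b : ℝ} (ha : -1 < a) (hb : -1 < b) {f : ℝ → ℝ}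
    (hf : MemLp f 2 (logMeasure a b)) (n : ℕ) :
    ∃! P : ℝ[X], P ∈ degreeLT ℝ n ∧ ∀ Q ∈ degreeLT ℝ n,
      ∫ t, (f t - P.eval (Real.log t)) * Q.eval (Real.log t) ∂logMeasure a b = 0 := by
  have hinner : ∀ P Q : ℝ[X], inner ℝ (hf.toLp f - logPolyLp ha hb P) (logPolyLp ha hb Q) =
      ∫ t, (f t - P.eval (Real.log t)) * Q.eval (Real.log t) ∂logMeasure a b := by
    intro P Q
    rw [logPolyLp_apply, logPolyLp_apply, ← MemLp.toLp_sub, inner_toLp]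
    rfl
  obtain ⟨P, hP, hPf⟩ := exists_mem_degreeLT_inner_sub_eq_zero (logPolyLp ha hb) n (hf.toLp f)
  refine ⟨P, ⟨hP, fun Q hQ => by rw [← hinner, hPf Q hQ]⟩, fun P' hP' => ?_⟩
  have hsub := sub_mem hP hP'.1
  have h1 := hPf _ hsub
  have h2 := hP'.2 _ hsub
  rw [← hinner] at h2
  have h3 : inner ℝ (logPolyLp ha hb (P - P')) (logPolyLp ha hb (P - P')) = 0 := by
    have : logPolyLp ha hb (P - P') =
        (hf.toLp f - logPolyLp ha hb P') - (hf.toLp f - logPolyLp ha hb P) := by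
      rw [map_sub]
      abel
    nth_rewrite 1 [this]
    rw [inner_sub_left, h1, h2, sub_zero]
  rw [inner_self_eq_zero] at h3
  exact (sub_eq_zero.1 (logPolyLp_injective ha hb (h3.trans (map_zero _).symm))).symm

lemma iterate_derivative_mem_degreeLT {n j : ℕ} {P : ℝ[X]} (hP : P ∈ degreeLT ℝ n) (hj : j ≤ n) :
    derivative^[j] P ∈ degreeLT ℝ (n - j) := by
  induction j with
  | zero => exact hP
  | succ j ih =>
    rw [Function.iterate_succ_apply']
    refine derivative_mem_degreeLT ?_
    rw [show n - (j + 1) + 1 = n - j by omega]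
    exact ih (by omega)

/-! ### Iterating the inequality along successive derivatives. -/

section Chain

variable {α b : ℝ} {m n : ℕ} {F : ℕ → ℝ → ℝ} {P : ℝ[X]}

lemma HasLogDeriv.sub_iterate_derivative {j : ℕ} (hF : HasLogDeriv (F j) (F (j + 1))) :
    HasLogDeriv (fun t => F j t - (derivative^[j] P).eval (Real.log t))
      (fun t => F (j + 1) t - (derivative^[j + 1] P).eval (Real.log t)) := by
  rw [Function.iterate_succ_apply']
  exact hF.sub (hasLogDeriv_polynomial_log _)

variable (hα : -1 < α) (hb : -1 < b) (hF : ∀ j < m, HasLogDeriv (F j) (F (j + 1)))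
  (hF2 : ∀ j ≤ m, MemLp (F j) 2 (logMeasure (α + j) b)) (hP : P ∈ degreeLT ℝ n)
  (hPF : ∀ Q ∈ degreeLT ℝ n,
    ∫ t, (F 0 t - P.eval (Real.log t)) * Q.eval (Real.log t) ∂logMeasure α b = 0)

include hα hb hF2 in
lemma memLp_sub_iterate_derivative {j : ℕ} (hj : j ≤ m) :
    MemLp (fun t => F j t - (derivative^[j] P).eval (Real.log t)) 2 (logMeasure (α + j) b) := by
  have : (0 : ℝ) ≤ j := j.cast_nonneg
  exact (hF2 j hj).sub (memLp_polynomial_log (by linarith) hb _)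

include hα hb hF hF2 hPF in
-- Integration by parts trades one derivative of the error for one degree of the test polynomial,
-- since `logAdjoint` sends degree below `n - (j + 1)` to degree below `n - j`.
lemma integral_sub_iterate_derivative_mul_eq_zero {j : ℕ} (hj : j ≤ min m n) :
    ∀ Q ∈ degreeLT ℝ (n - j), ∫ t, (F j t - (derivative^[j] P).eval (Real.log t)) *
      Q.eval (Real.log t) ∂logMeasure (α + j) b = 0 := by
  induction j with
  | zero => simpa using hPF
  | succ j ih =>
    intro Q hQ
    have hjm : j + 1 ≤ m := hj.trans (min_le_left _ _)
    have hjn : j + 1 ≤ n := hj.trans (min_le_right _ _)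
    have : (0 : ℝ) ≤ j := j.cast_nonneg
    have h1 := memLp_sub_iterate_derivative (P := P) hα hb hF2 hjm
    have h2 := memLp_sub_iterate_derivative (P := P) hα hb hF2 (by omega : j ≤ m)
    have e : α + ((j + 1 : ℕ) : ℝ) = α + j + 1 := by push_cast; ring
    rw [e] at h1 ⊢
    rw [(HasLogDeriv.sub_iterate_derivative (hF j hjm)).integral_mul_eval
      (by linarith) hb h2 h1 Q]
    refine ih (by omega) _ ?_
    rw [show n - j = n - (j + 1) + 1 by omega]
    exact logAdjoint_mem_degreeLT _ _ hQ

include hα hb hF hF2 hPF in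
-- Each Poincaré step contributes `(b + 1)(n - k)`; the factorials telescope this product. The
-- induction is on the number `d` of steps left.
lemma pow_mul_factorial_mul_eLpNorm_sq_le (d k : ℕ) (hk : k + d = min m n) :
    (b + 1) ^ d * (Nat.factorial (n - k) : ℝ) *
      (eLpNorm (fun t => F k t - (derivative^[k] P).eval (Real.log t)) 2
        (logMeasure (α + k) b)).toReal ^ 2 ≤
    (Nat.factorial (n - min m n) : ℝ) *
      (eLpNorm (fun t => F (min m n) t - (derivative^[min m n] P).eval (Real.log t)) 2
        (logMeasure (α + (min m n : ℕ)) b)).toReal ^ 2 := by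
  induction d generalizing k with
  | zero =>
    obtain rfl : k = min m n := hk
    simp
  | succ d ih =>
    refine le_trans ?_ (ih (k + 1) (by omega))
    have hkm : k + 1 ≤ m := by omega
    have : (0 : ℝ) ≤ k := k.cast_nonneg
    have h1 := memLp_sub_iterate_derivative (P := P) hα hb hF2 hkm
    have h2 := memLp_sub_iterate_derivative (P := P) hα hb hF2 (by omega : k ≤ m)
    have e : α + ((k + 1 : ℕ) : ℝ) = α + k + 1 := by push_cast; ring
    rw [e] at h1 ⊢
    have h3 := (HasLogDeriv.sub_iterate_derivative (hF k hkm)).mul_eLpNorm_sq_le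
      (by linarith) hb h2 h1 (integral_sub_iterate_derivative_mul_eq_zero hα hb hF hF2 hPF
        (by omega))
    have h4 : Nat.factorial (n - k) = (n - k) * Nat.factorial (n - (k + 1)) := by
      rw [show n - k = n - (k + 1) + 1 by omega, Nat.factorial_succ]
    have hb0 : 0 ≤ (b + 1) ^ d * (Nat.factorial (n - (k + 1)) : ℝ) :=
      mul_nonneg (pow_nonneg (by linarith) _) (Nat.cast_nonneg _)
    have h5 := mul_le_mul_of_nonneg_left h3 hb0
    rw [h4]
    refine le_trans (le_of_eq ?_) h5
    push_cast
    ring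

include hα hb hF hF2 hP hPF in
-- Pythagoras: the subtracted polynomial has degree below `n - M`, exactly the range to which the
-- error is orthogonal.
lemma eLpNorm_sub_iterate_derivative_le :
    (eLpNorm (fun t => F (min m n) t - (derivative^[min m n] P).eval (Real.log t)) 2
        (logMeasure (α + (min m n : ℕ)) b)).toReal ≤
      (eLpNorm (F (min m n)) 2 (logMeasure (α + (min m n : ℕ)) b)).toReal := by
  set M := min m n
  have : (0 : ℝ) ≤ M := M.cast_nonneg
  have hαM : -1 < α + M := by linarith
  have h1 := memLp_sub_iterate_derivative (P := P) hα hb hF2 (min_le_left m n)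
  have h2 := hF2 M (min_le_left m n)
  rw [← Lp.norm_toLp _ h1, ← Lp.norm_toLp _ h2]
  have h3 : h2.toLp = h1.toLp + logPolyLp hαM hb (derivative^[M] P) := by
    rw [logPolyLp_apply, ← MemLp.toLp_add]
    exact MemLp.toLp_congr _ _ (.of_forall fun t => by simp [M])
  have h4 : inner ℝ h1.toLp (logPolyLp hαM hb (derivative^[M] P)) = 0 := by
    rw [logPolyLp_apply, inner_toLp]
    exact integral_sub_iterate_derivative_mul_eq_zero hα hb hF hF2 hPF le_rfl _
      (iterate_derivative_mem_degreeLT hP (min_le_right m n))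
  refine le_of_sq_le_sq ?_ (norm_nonneg _)
  rw [h3, norm_add_sq_real, h4]
  nlinarith [sq_nonneg ‖logPolyLp hαM hb (derivative^[M] P)‖]

end Chain

/-! ### Reduction of pseudo-derivatives to logarithmic derivatives. -/

/-- The iterated pseudo-derivative, without its power factor. -/
noncomputable def reduced (γ : ℝ) (u : ℝ → ℝ) (j : ℕ) : ℝ → ℝ :=
  fun s => s ^ (-γ) * (pseudoDeriv γ)^[j] u s

lemma rpow_mul_rpow_neg_mul {t : ℝ} (ht : 0 < t) (γ x : ℝ) : t ^ γ * (t ^ (-γ) * x) = x := by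
  rw [← mul_assoc, ← Real.rpow_add ht]
  simp

lemma rpow_neg_mul_rpow_mul {t : ℝ} (ht : 0 < t) (γ x : ℝ) : t ^ (-γ) * (t ^ γ * x) = x := by
  rw [← mul_assoc, ← Real.rpow_add ht]
  simp

lemma reduced_succ (γ : ℝ) (u : ℝ → ℝ) (j : ℕ) {t : ℝ} (ht : 0 < t) :
    reduced γ u (j + 1) t = t * weakDeriv (reduced γ u j) t := by
  rw [reduced, Function.iterate_succ_apply', pseudoDeriv, ← mul_assoc, ← Real.rpow_add ht,
    show -γ + (1 + γ) = 1 by ring, Real.rpow_one]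
  rfl

lemma eLpNorm_iterate_pseudoDeriv (a lam γ : ℝ) (u : ℝ → ℝ) (j : ℕ) :
    eLpNorm ((pseudoDeriv γ)^[j] u) 2 (logMeasure a lam) =
      eLpNorm (reduced γ u j) 2 (logMeasure a (lam + 2 * γ)) := by
  rw [← eLpNorm_rpow_mul]
  refine eLpNorm_congr_ae ?_
  filter_upwards [ae_mem_Ioo_logMeasure a lam] with t ht
  rw [reduced, rpow_mul_rpow_neg_mul ht.1]

lemma memLp_iterate_pseudoDeriv_iff {a lam γ : ℝ} {u : ℝ → ℝ} {j : ℕ} :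
    MemLp ((pseudoDeriv γ)^[j] u) 2 (logMeasure a lam) ↔
      MemLp (reduced γ u j) 2 (logMeasure a (lam + 2 * γ)) := by
  rw [← memLp_rpow_mul_iff]
  refine memLp_congr_ae ?_
  filter_upwards [ae_mem_Ioo_logMeasure a lam] with t ht
  rw [reduced, rpow_mul_rpow_neg_mul ht.1]

lemma hasLogDeriv_reduced_iff {γ : ℝ} {u : ℝ → ℝ} {j : ℕ} :
    HasLogDeriv (reduced γ u j) (reduced γ u (j + 1)) ↔ WeaklyDifferentiable (reduced γ u j) := by
  refine ⟨fun h => h.weaklyDifferentiable, fun h => ⟨_, h.hasWeakDeriv, ?_⟩⟩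
  filter_upwards [ae_restrict_mem measurableSet_Ioo] with t ht
  exact reduced_succ γ u j ht.1

lemma memA_iff {m : ℕ} {α β lam : ℝ} {u : ℝ → ℝ} :
    MemA m α β lam u ↔
      (∀ j < m, HasLogDeriv (reduced ((β - lam) / 2) u j) (reduced ((β - lam) / 2) u (j + 1))) ∧
      ∀ j ≤ m, MemLp (reduced ((β - lam) / 2) u j) 2 (logMeasure (α + j) β) := by
  have e : lam + 2 * ((β - lam) / 2) = β := by ring
  simp only [MemA, memLp_iterate_pseudoDeriv_iff, e, hasLogDeriv_reduced_iff]
  rfl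

/-- `weakDeriv` is an arbitrary choice, so linearity of the iterated pseudo-derivative holds only
almost everywhere and is carried through the iteration by `HasLogDeriv.congr_left`. -/
lemma reduced_sub_polynomial_log {γ : ℝ} {u : ℝ → ℝ} {m : ℕ}
    (hu : ∀ j < m, HasLogDeriv (reduced γ u j) (reduced γ u (j + 1))) (P : ℝ[X]) {j : ℕ}
    (hj : j ≤ m) :
    (fun t => reduced γ u j t - (derivative^[j] P).eval (Real.log t))
      =ᵐ[volume.restrict (Ioo (0 : ℝ) 1)]
      reduced γ (fun t => u t - t ^ γ * P.eval (Real.log t)) j := by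
  induction j with
  | zero =>
    filter_upwards [ae_restrict_mem measurableSet_Ioo] with t ht
    simp only [reduced, Function.iterate_zero_apply, mul_sub, rpow_neg_mul_rpow_mul ht.1]
  | succ j ih =>
    have h := (HasLogDeriv.sub_iterate_derivative (P := P) (F := reduced γ u)
      (hu j hj)).congr_left (ih (by omega))
    filter_upwards [h.ae_eq_mul_weakDeriv, ae_restrict_mem measurableSet_Ioo] with t h1 ht
    rw [h1, reduced_succ _ _ _ ht.1]

lemma isProjection_iff {N : ℕ} {α β lam : ℝ} {u p : ℝ → ℝ} :
    IsProjection N α β lam u p ↔ ∃ P : ℝ[X],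
      (P ∈ degreeLT ℝ (N + 1) ∧ ∀ Q ∈ degreeLT ℝ (N + 1),
        ∫ t, (reduced ((β - lam) / 2) u 0 t - P.eval (Real.log t)) * Q.eval (Real.log t)
          ∂logMeasure α β = 0) ∧
      p = fun t => t ^ ((β - lam) / 2) * P.eval (Real.log t) := by
  have e : lam + 2 * ((β - lam) / 2) = β := by ring
  have key : ∀ P Q : ℝ[X],
      ∫ t, (u t - t ^ ((β - lam) / 2) * P.eval (Real.log t)) *
        (t ^ ((β - lam) / 2) * Q.eval (Real.log t)) ∂logMeasure α lam =
      ∫ t, (reduced ((β - lam) / 2) u 0 t - P.eval (Real.log t)) * Q.eval (Real.log t)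
        ∂logMeasure α β := by
    intro P Q
    conv_rhs => rw [← e]
    rw [← integral_rpow_mul_mul]
    refine integral_congr_ae ?_
    filter_upwards [ae_mem_Ioo_logMeasure α lam] with t ht
    rw [reduced, mul_sub, e, rpow_mul_rpow_neg_mul ht.1, Function.iterate_zero_apply]
  constructor
  · rintro ⟨⟨q, hq, rfl⟩, h⟩
    obtain ⟨P, hP, rfl⟩ := mem_logPoly_iff.1 hq
    exact ⟨P, ⟨hP, fun Q hQ => by rw [← key, h _ (mem_logPoly_iff.2 ⟨Q, hQ, rfl⟩)]⟩, rfl⟩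
  · rintro ⟨P, ⟨hP, h⟩, rfl⟩
    refine ⟨⟨_, mem_logPoly_iff.2 ⟨P, hP, rfl⟩, rfl⟩, fun q hq => ?_⟩
    obtain ⟨Q, hQ, rfl⟩ := mem_logPoly_iff.1 hq
    rw [key, h Q hQ]

lemma le_sqrt_mul_of_mul_sq_le {c A B x y : ℝ} {k M : ℕ} (hc : 0 < c) (hA : 0 < A) (hB : 0 ≤ B)
    (hy : 0 ≤ y) (hkM : k ≤ M) (h : c ^ (M - k) * A * x ^ 2 ≤ B * y ^ 2) :
    x ≤ Real.sqrt (c ^ ((k : ℤ) - (M : ℤ)) * (B / A)) * y := by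
  have hpow : c ^ ((k : ℤ) - (M : ℤ)) = (c ^ (M - k))⁻¹ := by
    rw [← zpow_natCast, ← zpow_neg, Nat.cast_sub hkM, neg_sub]
  have hcp : 0 < c ^ (M - k) := pow_pos hc _
  refine le_of_sq_le_sq ?_ (by positivity)
  rw [mul_pow, Real.sq_sqrt (by positivity), hpow,
    show (c ^ (M - k))⁻¹ * (B / A) * y ^ 2 = (B * y ^ 2) / (c ^ (M - k) * A) by field_simp,
    le_div_iff₀ (by positivity)]
  linarith

end GLOF

/-! ### The main estimate. -/

theorem mainTheorem4 (m N k : ℕ) (α β lam : ℝ) (hα : -1 < α) (hβ : -1 < β)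
    (u : ℝ → ℝ) (hu : GLOF.MemA m α β lam u) (hk : k ≤ min m (N + 1)) :
    (∃! p : ℝ → ℝ, GLOF.IsProjection N α β lam u p) ∧
    ∀ p : ℝ → ℝ, GLOF.IsProjection N α β lam u p →
      GLOF.MemA m α β lam (fun t => u t - p t) ∧
      eLpNorm ((GLOF.pseudoDeriv ((β - lam) / 2))^[k] (fun t => u t - p t)) 2
          (GLOF.logMeasure (α + k) lam)
        ≤ ENNReal.ofReal (Real.sqrt ((β + 1) ^ ((k : ℤ) - ((min m (N + 1) : ℕ) : ℤ)) *
              ((Nat.factorial (N + 1 - min m (N + 1)) : ℝ) /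
                (Nat.factorial (N + 1 - k) : ℝ)))) *
          eLpNorm ((GLOF.pseudoDeriv ((β - lam) / 2))^[min m (N + 1)] u) 2
            (GLOF.logMeasure (α + (min m (N + 1) : ℕ)) lam) := by
  obtain ⟨hF, hF2⟩ := GLOF.memA_iff.1 hu
  refine ⟨?_, fun p hp => ?_⟩
  · obtain ⟨P, hP, huniq⟩ := GLOF.existsUnique_degreeLT_projection hα hβ
      (by simpa using hF2 0 m.zero_le) (N + 1)
    refine ⟨_, GLOF.isProjection_iff.2 ⟨P, hP, rfl⟩, fun p hp => ?_⟩
    obtain ⟨P', hP', rfl⟩ := GLOF.isProjection_iff.1 hp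
    rw [huniq P' hP']
  obtain ⟨P, ⟨hP, hPF⟩, rfl⟩ := GLOF.isProjection_iff.1 hp
  have hae : ∀ j ≤ m, _ := fun j hj => GLOF.reduced_sub_polynomial_log hF P hj
  have hE2 : ∀ j ≤ m, _ := fun j hj =>
    GLOF.memLp_sub_iterate_derivative (P := P) hα hβ hF2 (j := j) hj
  constructor
  · refine GLOF.memA_iff.2 ⟨fun j hj => ?_, fun j hj => ?_⟩
    · rw [GLOF.hasLogDeriv_reduced_iff]
      exact ((GLOF.HasLogDeriv.sub_iterate_derivative (hF j hj)).congr_left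
        (hae j hj.le)).weaklyDifferentiable
    · refine (memLp_congr_ae ?_).1 (hE2 j hj)
      have := hae j hj
      rwa [Filter.EventuallyEq, ← GLOF.ae_logMeasure (α + j) β] at this
  · have hkm : k ≤ m := hk.trans (min_le_left _ _)
    have e : lam + 2 * ((β - lam) / 2) = β := by ring
    have hnorm := hae k hkm
    rw [Filter.EventuallyEq, ← GLOF.ae_logMeasure (α + k) β] at hnorm
    rw [GLOF.eLpNorm_iterate_pseudoDeriv, GLOF.eLpNorm_iterate_pseudoDeriv, e,
      -- Both norms are finite, so the estimate reduces to one between real numbers.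
      ← eLpNorm_congr_ae hnorm, ← ENNReal.ofReal_toReal (hE2 k hkm).eLpNorm_ne_top,
      ← ENNReal.ofReal_toReal (hF2 _ (min_le_left m (N + 1))).eLpNorm_ne_top,
      ← ENNReal.ofReal_mul (Real.sqrt_nonneg _)]
    refine ENNReal.ofReal_le_ofReal ?_
    refine GLOF.le_sqrt_mul_of_mul_sq_le (by linarith) (by positivity) (by positivity)
      ENNReal.toReal_nonneg hk ?_
    refine (GLOF.pow_mul_factorial_mul_eLpNorm_sq_le hα hβ hF hF2 hPF _ k (by omega)).trans ?_
    exact mul_le_mul_of_nonneg_left (pow_le_pow_left₀ ENNReal.toReal_nonneg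
      (GLOF.eLpNorm_sub_iterate_derivative_le hα hβ hF hF2 hP hPF) 2) (Nat.cast_nonneg _)
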